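/- Let $C\subset\mathbb R^n$ be a closed convex cone that contains no line and has interior points, and let $K$ be a $C$-pseudo-cone, that is, a nonempty closed convex set with $o\notin K$, $\lambda K\subseteq K$ for all $\lambda\ge 1$, and recession cone $C$. Let $K^*=\{u\in\mathbb R^n:\langle u,x\rangle\le -1 \text{ for all } x\in K\}$ be its copolar set. For a closed convex set $L$ and a boundary point $y$ of $L$, let $\nu_L(y)$ denote the outer unit normal vector of $L$ at $y$, and let $\kappa(L,y)$ denote the Gauss curvature of $\partial L$ at $y$, that is, the determinant of the differential at $y$ of the Gauss map $\nu_L:\partial L\to\mathbb S^{n-1}$, taken on the tangent space $\nu_L(y)^\perp$. A pair $(x,x^*)$ is called a crucial pair of $K$ if $x\in\partial K$ and $x^*$ is an outer normal vector of $K$ at $x$ with $\langle x,x^*\rangle=-1$. Assume that the radial function $\varrho_K(x)=\min\{\lambda>0:\lambda x\in K\}$ is twice continuously differentiable on $\operatorname{int}C$. Then for every crucial pair $(x,x^*)$ of $K$ with $x\in\operatorname{int}C$, $\kappa(K,x)>0$ and $\kappa(K^*,x^*)>0$, $$\frac{\langle x,\nu_K(x)\rangle}{\kappa(K,x)^{\frac1{n+1}}}\cdot\frac{\langle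 x^*,\nu_{K^*}(x^*)\rangle}{\kappa(K^*,x^*)^{\frac1{n+1}}}=1 .$$ In other words, the equiaffine support functions $\langle\cdot,\nu\rangle\,\kappa^{-1/(n+1)}$ of $K$ and $K^*$ are reciprocal at $x$ and $x^*$. In particular, this holds for all crucial pairs $(x,x^*)$ of $K$ with $x\in\operatorname{int}C$ if $K$ and $K^*$ have positive Gauss curvatures. -/

import Mathlib

noncomputable section

namespace PseudoCone

/-- Real Euclidean space of dimension `n` with its standard scalar product. -/
abbrev E (n : ℕ) : Type := EuclideanSpace ℝ (Fin n)

/-- A pseudo-cone: a nonempty closed convex set `K` with `0 ∉ K` and `c K ⊆ K` for all `c ≥ 1`. -/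
structure IsPseudoCone {n : ℕ} (K : Set (E n)) : Prop where
  nonempty : K.Nonempty
  isClosed : IsClosed K
  convex : Convex ℝ K
  zero_notMem : (0 : E n) ∉ K
  smul_mem : ∀ c : ℝ, 1 ≤ c → ∀ x ∈ K, c • x ∈ K

/-- The recession cone of a set: all `z` with `x + c z ∈ K` for all `x ∈ K` and `c ≥ 0`. -/
def recessionCone {n : ℕ} (K : Set (E n)) : Set (E n) :=
  {z | ∀ x ∈ K, ∀ c : ℝ, 0 ≤ c → x + c • z ∈ K}

/-- A `C`-pseudo-cone: a pseudo-cone with recession cone `C`, where `C` is a closed convex cone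
that contains no line and has interior points. -/
structure IsCPseudoCone {n : ℕ} (C : ProperCone ℝ (E n)) (K : Set (E n)) : Prop where
  isPseudoCone : IsPseudoCone K
  recessionCone_eq : recessionCone K = (C : Set (E n))
  salient : ∀ z ∈ C, -z ∈ C → z = 0
  interior_nonempty : (interior (C : Set (E n))).Nonempty

/-- The copolar set `K* = {u : ⟨u, x⟩ ≤ -1 for all x ∈ K}`. -/
def copolar {n : ℕ} (K : Set (E n)) : Set (E n) :=
  {u | ∀ x ∈ K, inner ℝ u x ≤ -1}

/-- The radial function `ρ_K(x) = min {c > 0 : c x ∈ K}`. For a `C`-pseudo-cone and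
`x ∈ int C` the minimum exists. -/
def radialFunction {n : ℕ} (K : Set (E n)) (x : E n) : ℝ :=
  sInf {c : ℝ | 0 < c ∧ c • x ∈ K}

/-- `v` is an outer normal vector of `K` at `x`. -/
def IsOuterNormal {n : ℕ} (K : Set (E n)) (x v : E n) : Prop :=
  v ≠ 0 ∧ ∀ y ∈ K, inner ℝ v (y - x) ≤ 0

/-- `(x, x')` is a crucial pair of `K`: `x` is a boundary point of `K`, and `x'` is an outer
normal vector of `K` at `x` with `⟨x, x'⟩ = -1`. -/
def IsCrucialPair {n : ℕ} (K : Set (E n)) (x x' : E n) : Prop :=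
  x ∈ frontier K ∧ IsOuterNormal K x x' ∧ inner ℝ x x' = -1

/-- `ν_K(x)`: the outer unit normal vector of `K` at the boundary point `x` (some outer unit
normal vector, if there are several). -/
def outerUnitNormal {n : ℕ} (K : Set (E n)) (x : E n) : E n :=
  Classical.epsilon fun v => ‖v‖ = 1 ∧ IsOuterNormal K x v

/-- The tangent space of the boundary of `K` at `x`: the orthogonal complement of `ν_K(x)`. -/
abbrev tangentSpace {n : ℕ} (K : Set (E n)) (x : E n) : Submodule ℝ (E n) :=
  (Submodule.span ℝ {outerUnitNormal K x})ᗮ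

/-- The Weingarten map of the boundary of `K` at `x`, with respect to the outer unit normal: the
differential of the Gauss map `ν_K : ∂K → S^{n-1}`, as an endomorphism of the tangent space.
Where `∂K` is a hypersurface of class `C¹`, a derivative of `ν_K` within `∂K` is determined on
the tangent space, and only its restriction to the tangent space is used. The signs are such
that the eigenvalues (the principal curvatures) are nonnegative for convex `K`. -/
def weingartenMap {n : ℕ} (K : Set (E n)) (x : E n) :
    tangentSpace K x →L[ℝ] tangentSpace K x :=
  (tangentSpace K x).orthogonalProjectionOnto ∘L
    fderivWithin ℝ (outerUnitNormal K) (frontier K) x ∘L (tangentSpace K x).subtypeL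

/-- `κ(K, x)`: the Gauss curvature of the boundary of `K` at `x`, that is, the determinant of the
Weingarten map (the product of the principal curvatures). -/
def gaussCurvature {n : ℕ} (K : Set (E n)) (x : E n) : ℝ :=
  (weingartenMap K x).det

/-- The equiaffine support function `⟨x, ν_K(x)⟩ κ(K, x)^{-1/(n+1)}` of `K` at `x`. -/
def equiaffineSupport {n : ℕ} (K : Set (E n)) (x : E n) : ℝ :=
  inner ℝ x (outerUnitNormal K x) * gaussCurvature K x ^ (-(1 / ((n : ℝ) + 1)))

end PseudoCone

end

/-! Let h = 1/ρ_K², which is C² and homogeneous of degree 2 on int C, and let F = -∇h/2. Euler's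
identity gives ⟨F y, y⟩ = -h y. Near a boundary point x in int C, K is {h ≥ 1}, so F x is normal to
K with ⟨F x, x⟩ = -1, and hence x* = F x. Moreover F y ∈ K* exactly when h y ≥ 1. Positive curvature
of K makes A = DF(x) invertible, and the local inverse G of F plays for K* the role that F plays for
K. `IsNormalChart` is the local description shared by both sets.

Since ν_K = F/‖F‖ on ∂K, the curvature at x is ‖F x‖^{-(n-1)} times the determinant of A compressed
to (F x)^⊥; likewise for K* with A⁻¹ and x^⊥. Differentiating Euler's identity shows that A maps (F
x)^⊥ to x^⊥. The two determinants therefore multiply to the squared cosine of the angle between x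
and F x, namely (‖x‖‖F x‖)^{-2}, and the curvatures to (‖x‖‖F x‖)^{-(n+1)}. The two inner products
are -1/‖F x‖ and -1/‖x‖, so everything cancels. -/

noncomputable section

open Filter Topology Module

namespace PseudoCone

/-! ### Linear algebra: compressions to hyperplanes. -/

/-- The compression of an operator to a subspace. -/
def compression {n : ℕ} (S : Submodule ℝ (E n)) (A : E n →L[ℝ] E n) : S →L[ℝ] S :=
  S.orthogonalProjectionOnto ∘L A ∘L S.subtypeL

theorem mem_orthogonal_span_singleton {n : ℕ} {a v : E n} :
    v ∈ (Submodule.span ℝ {a})ᗮ ↔ inner ℝ a v = 0 :=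
  Submodule.mem_orthogonal_singleton_iff_inner_right

theorem coe_orthogonalProjectionOnto_orthogonal_span_singleton {n : ℕ} (a v : E n) :
    (((Submodule.span ℝ {a})ᗮ.orthogonalProjectionOnto v : (Submodule.span ℝ {a})ᗮ) : E n) =
      v - (inner ℝ a v / ‖a‖ ^ 2) • a := by
  rw [Submodule.orthogonalProjectionOnto_orthogonal]
  simp [Submodule.starProjection_singleton]

/-- The composition of the orthogonal projections between two hyperplanes has the squared cosine
of the angle between their normals as its determinant. -/
theorem det_projection_comp_projection {n : ℕ} {a b : E n} (hb : b ≠ 0) (ha : a ≠ 0) :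
    LinearMap.det
      (((Submodule.span ℝ {a})ᗮ.orthogonalProjectionOnto ∘L
        (Submodule.span ℝ {b})ᗮ.subtypeL ∘L
        (Submodule.span ℝ {b})ᗮ.orthogonalProjectionOnto ∘L
        (Submodule.span ℝ {a})ᗮ.subtypeL : _ →L[ℝ] (Submodule.span ℝ {a})ᗮ) :
        (Submodule.span ℝ {a})ᗮ →ₗ[ℝ] (Submodule.span ℝ {a})ᗮ) =
      inner ℝ a b ^ 2 / (‖a‖ ^ 2 * ‖b‖ ^ 2) := by
  set S := (Submodule.span ℝ {a})ᗮ with hS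
  -- Projecting v ∈ S to b^⊥ subtracts (⟨b, v⟩/‖b‖²) b, and projecting back fixes v. The result is
  -- the identity plus a rank-one map, with determinant one plus a pairing.
  have key : ((S.orthogonalProjectionOnto ∘L
        (Submodule.span ℝ {b})ᗮ.subtypeL ∘L
        (Submodule.span ℝ {b})ᗮ.orthogonalProjectionOnto ∘L
        S.subtypeL : _ →L[ℝ] S) : S →ₗ[ℝ] S) =
      LinearMap.transvection
        ((-(1 / ‖b‖ ^ 2)) • ((innerSL ℝ b ∘L S.subtypeL : S →L[ℝ] ℝ) : S →ₗ[ℝ] ℝ))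
        (S.orthogonalProjectionOnto b) := by
    ext v : 1
    have hv : S.orthogonalProjectionOnto (v : E n) = v :=
      Submodule.orthogonalProjectionOnto_mem_subspace_eq_self v
    simp only [LinearMap.transvection.apply, ContinuousLinearMap.coe_coe,
      ContinuousLinearMap.comp_apply, Submodule.subtypeL_apply,
      coe_orthogonalProjectionOnto_orthogonal_span_singleton, map_sub, map_smul, hv,
      LinearMap.smul_apply, innerSL_apply_apply, smul_eq_mul]
    rw [sub_eq_add_neg, ← neg_smul]
    congr 2
    ring
  rw [key, LinearMap.transvection.det]
  have hpb : ((S.orthogonalProjectionOnto b : S) : E n) = b - (inner ℝ a b / ‖a‖ ^ 2) • a :=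
    coe_orthogonalProjectionOnto_orthogonal_span_singleton a b
  simp only [LinearMap.smul_apply, ContinuousLinearMap.coe_coe, ContinuousLinearMap.comp_apply,
    Submodule.subtypeL_apply, innerSL_apply_apply, smul_eq_mul, hpb, inner_sub_right,
    inner_smul_right, real_inner_self_eq_norm_sq, real_inner_comm a b]
  have h1 : ‖a‖ ≠ 0 := norm_ne_zero_iff.2 ha
  have h2 : ‖b‖ ≠ 0 := norm_ne_zero_iff.2 hb
  field_simp
  ring

/-- If `A` maps the hyperplane orthogonal to `b` to the hyperplane orthogonal to `a`, then the
compressions of `A` and of its inverse have reciprocal determinants, up to the angle factor. -/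
theorem det_compression_mul_det_compression_symm {n : ℕ} {a b : E n} (ha : a ≠ 0) (hb : b ≠ 0)
    (A : E n ≃L[ℝ] E n) (hA : ∀ v, inner ℝ a (A v) = inner ℝ b v) :
    (compression (Submodule.span ℝ {b})ᗮ (A : E n →L[ℝ] E n)).det *
      (compression (Submodule.span ℝ {a})ᗮ (A.symm : E n →L[ℝ] E n)).det =
      inner ℝ a b ^ 2 / (‖a‖ ^ 2 * ‖b‖ ^ 2) := by
  set S := (Submodule.span ℝ {a})ᗮ with hS
  set T := (Submodule.span ℝ {b})ᗮ with hT
  have hTS : ∀ v : T, A v ∈ S := fun v => by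
    rw [hS, mem_orthogonal_span_singleton, hA, ← mem_orthogonal_span_singleton]
    exact v.2
  have hST : ∀ v : S, A.symm v ∈ T := fun v => by
    rw [hT, mem_orthogonal_span_singleton, ← hA, A.apply_symm_apply,
      ← mem_orthogonal_span_singleton]
    exact v.2
  let e : S ≃ₗ[ℝ] T :=
    { toFun := fun v => ⟨A.symm v, hST v⟩
      invFun := fun v => ⟨A v, hTS v⟩
      map_add' := fun v w => by ext1; simp
      map_smul' := fun c v => by ext1; simp
      left_inv := fun v => by ext1; simp
      right_inv := fun v => by ext1; simp }
  -- Conjugation by e = A⁻¹ moves the second compression to T; composed with the first, A and A⁻¹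
  -- cancel and only the two projections remain.
  have hconj := LinearMap.det_conj
    (compression S (A.symm : E n →L[ℝ] E n) : S →ₗ[ℝ] S) e
  unfold ContinuousLinearMap.det
  rw [← hconj, ← LinearMap.det_comp, real_inner_comm, mul_comm (‖a‖ ^ 2),
    ← det_projection_comp_projection ha hb]
  congr 1
  ext v : 1
  simp [compression, e, S, T]

/-! ### Normals and curvature of a superlevel set. -/

/-- Near `p`, the set `L` is the superlevel set `{1 ≤ h}` of a differentiable function `h` with
gradient `-2 F`, where `⟨F y, y⟩ = -h y`, and `p` lies on the level set `{h = 1}`. -/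
structure IsNormalChart {n : ℕ} (L : Set (E n)) (h : E n → ℝ) (F : E n → E n) (p : E n) :
    Prop where
  mem_iff : ∀ᶠ y in 𝓝 p, (y ∈ L ↔ 1 ≤ h y)
  hasFDerivAt : ∀ᶠ y in 𝓝 p, HasFDerivAt h (innerSL ℝ ((-2 : ℝ) • F y)) y
  inner_self : ∀ᶠ y in 𝓝 p, inner ℝ (F y) y = -h y
  value : h p = 1

namespace IsNormalChart

variable {n : ℕ} {L : Set (E n)} {h : E n → ℝ} {F : E n → E n} {p : E n}

theorem eventually (H : IsNormalChart L h F p) :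
    ∀ᶠ y in 𝓝 p, h y = 1 → IsNormalChart L h F y := by
  filter_upwards [H.mem_iff.eventually_nhds, H.hasFDerivAt.eventually_nhds,
    H.inner_self.eventually_nhds] with y h1 h2 h3 h4
  exact ⟨h1, h2, h3, h4⟩

theorem inner_eq (H : IsNormalChart L h F p) : inner ℝ (F p) p = -1 := by
  rw [H.inner_self.self_of_nhds, H.value]

theorem normal_ne_zero (H : IsNormalChart L h F p) : F p ≠ 0 := by
  intro h0
  have := H.inner_eq
  simp [h0] at this

theorem mem (H : IsNormalChart L h F p) : p ∈ L :=
  H.mem_iff.self_of_nhds.2 H.value.ge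

theorem isLocalMinOn (H : IsNormalChart L h F p) : IsLocalMinOn h L p := by
  have := H.mem_iff.filter_mono (nhdsWithin_le_nhds (s := L))
  filter_upwards [this, self_mem_nhdsWithin] with y hy hyL
  rw [H.value]
  exact hy.1 hyL

theorem mem_frontier (H : IsNormalChart L h F p) : p ∈ frontier L := by
  refine ⟨subset_closure H.mem, fun hp => ?_⟩
  have hmin : IsLocalMin h p :=
    H.isLocalMinOn.isLocalMin (mem_interior_iff_mem_nhds.1 hp)
  have h0 := hmin.hasFDerivAt_eq_zero H.hasFDerivAt.self_of_nhds
  have h1 := congrArg (fun f : E n →L[ℝ] ℝ => f p) h0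
  simp [H.inner_eq] at h1

theorem eventually_value_of_mem_frontier (H : IsNormalChart L h F p) :
    ∀ᶠ y in 𝓝 p, y ∈ frontier L → h y = 1 := by
  filter_upwards [H.mem_iff.eventually_nhds, H.hasFDerivAt] with y h1 h2 hy
  have hc : ContinuousAt h y := h2.continuousAt
  rcases lt_trichotomy (h y) 1 with hlt | heq | hgt
  · have : Lᶜ ∈ 𝓝 y := by
      filter_upwards [h1, hc.eventually_lt continuousAt_const hlt] with z hz hz' hzL
      exact absurd (hz.1 hzL) (not_le.2 hz')
    rw [← frontier_compl] at hy
    exact absurd (mem_interior_iff_mem_nhds.2 this) hy.2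
  · exact heq
  · have : L ∈ 𝓝 y := by
      filter_upwards [h1, continuousAt_const.eventually_lt hc hgt] with z hz hz'
      exact hz.2 hz'.le
    exact absurd (mem_interior_iff_mem_nhds.2 this) hy.2

theorem isOuterNormal (H : IsNormalChart L h F p) (hL : Convex ℝ L) :
    IsOuterNormal L p (F p) := by
  refine ⟨H.normal_ne_zero, fun y hy => ?_⟩
  have := H.isLocalMinOn.hasFDerivWithinAt_nonneg
    H.hasFDerivAt.self_of_nhds.hasFDerivWithinAt
    (sub_mem_posTangentConeAt_of_segment_subset (hL.segment_subset H.mem hy))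
  simp only [innerSL_apply_apply, inner_smul_left] at this
  simp at this
  linarith

theorem eventually_add_smul_mem (H : IsNormalChart L h F p) {d : E n}
    (hd : inner ℝ (F p) d < 0) : ∀ᶠ t : ℝ in 𝓝[>] 0, p + t • d ∈ L := by
  have hline : HasDerivAt (fun t : ℝ => p + t • d) d 0 := by
    simpa using ((hasDerivAt_id (0 : ℝ)).smul_const d).const_add p
  have hp : p + (0 : ℝ) • d = p := by simp
  have hder : HasDerivAt (fun t : ℝ => h (p + t • d)) ((-2) * inner ℝ (F p) d) 0 := by
    have h1 : HasFDerivAt h (innerSL ℝ ((-2 : ℝ) • F p)) (p + (0 : ℝ) • d) := by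
      rw [hp]; exact H.hasFDerivAt.self_of_nhds
    have := h1.comp_hasDerivAt (0 : ℝ) hline
    rwa [innerSL_apply_apply, real_inner_smul_left] at this
  rw [hasDerivAt_iff_tendsto_slope_zero] at hder
  have hpos := (hder.eventually
    (lt_mem_nhds (show 0 < (-2) * inner ℝ (F p) d by linarith))).filter_mono (nhdsGT_le_nhdsNE 0)
  have hmem : ∀ᶠ t : ℝ in 𝓝[>] 0, (p + t • d ∈ L ↔ 1 ≤ h (p + t • d)) := by
    have : Tendsto (fun t : ℝ => p + t • d) (𝓝[>] 0) (𝓝 p) := by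
      have := hline.continuousAt.tendsto
      rw [hp] at this
      exact this.mono_left nhdsWithin_le_nhds
    exact this.eventually H.mem_iff
  filter_upwards [hpos, hmem, self_mem_nhdsWithin] with t h1 h2 (h3 : 0 < t)
  rw [h2]
  simp only [zero_add, zero_smul, add_zero, H.value, smul_eq_mul] at h1
  have := pos_of_mul_pos_right h1 (inv_pos.2 h3).le
  linarith

/-- Every direction d with ⟨F p, d⟩ < 0 enters L, so an outer normal is nonpositive on that open
half-space and, by continuity, on its closure. This forces it onto the ray of F p. -/
theorem exists_pos_smul_of_isOuterNormal (H : IsNormalChart L h F p) {v : E n}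
    (hv : IsOuterNormal L p v) : ∃ c : ℝ, 0 < c ∧ v = c • F p := by
  have hneg : ∀ d, inner ℝ (F p) d < 0 → inner ℝ v d ≤ 0 := fun d hd => by
    obtain ⟨t, ht, ht0⟩ := ((H.eventually_add_smul_mem hd).and self_mem_nhdsWithin).exists
    have := hv.2 _ ht
    rw [add_sub_cancel_left, inner_smul_right] at this
    exact nonpos_of_mul_nonpos_right this ht0
  have hle : ∀ d, inner ℝ (F p) d ≤ 0 → inner ℝ v d ≤ 0 := fun d hd => by
    have hlim : Tendsto (fun t : ℝ => inner ℝ v (d + t • p)) (𝓝[>] 0) (𝓝 (inner ℝ v d)) := by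
      have : Continuous fun t : ℝ => inner ℝ v (d + t • p) := by fun_prop
      have h0 := this.tendsto 0
      simp only [zero_smul, add_zero] at h0
      exact h0.mono_left nhdsWithin_le_nhds
    -- Since ⟨F p, p⟩ = -1, adding t p pushes d into the open half-space.
    refine le_of_tendsto hlim ?_
    filter_upwards [self_mem_nhdsWithin] with t (ht : 0 < t)
    refine hneg _ ?_
    rw [inner_add_right, inner_smul_right, H.inner_eq]
    linarith
  have hF : 0 < ‖F p‖ ^ 2 := by
    have := norm_pos_iff.2 H.normal_ne_zero
    positivity
  set c : ℝ := inner ℝ (F p) v / ‖F p‖ ^ 2 with hc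
  have horth : inner ℝ (F p) (v - c • F p) = 0 := by
    rw [inner_sub_right, inner_smul_right, real_inner_self_eq_norm_sq, hc,
      div_mul_cancel₀ _ hF.ne', sub_self]
  have hvc : v = c • F p := by
    have h1 := hle _ horth.le
    have h2 : inner ℝ (v - c • F p) (v - c • F p) = inner ℝ v (v - c • F p) := by
      rw [inner_sub_left, inner_smul_left, horth]
      simp
    rw [← sub_eq_zero, ← inner_self_eq_zero (𝕜 := ℝ)]
    exact le_antisymm (h2.trans_le h1) real_inner_self_nonneg
  refine ⟨c, lt_of_le_of_ne ?_ ?_, hvc⟩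
  · have := hle (-F p) (by rw [inner_neg_right, real_inner_self_eq_norm_sq]; linarith)
    rw [inner_neg_right, real_inner_comm] at this
    exact div_nonneg (by linarith) hF.le
  · intro h0
    exact hv.1 (by rw [hvc, ← h0, zero_smul])

theorem outerUnitNormal_eq (H : IsNormalChart L h F p) (hL : Convex ℝ L) :
    outerUnitNormal L p = ‖F p‖⁻¹ • F p := by
  have hF : 0 < ‖F p‖ := norm_pos_iff.2 H.normal_ne_zero
  have hex : ∃ v, ‖v‖ = 1 ∧ IsOuterNormal L p v := by
    refine ⟨‖F p‖⁻¹ • F p, norm_smul_inv_norm H.normal_ne_zero,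
      smul_ne_zero (inv_ne_zero hF.ne') H.normal_ne_zero, fun y hy => ?_⟩
    rw [inner_smul_left]
    exact mul_nonpos_of_nonneg_of_nonpos (inv_nonneg.2 hF.le) ((H.isOuterNormal hL).2 y hy)
  obtain ⟨h1, h2⟩ := Classical.epsilon_spec hex
  obtain ⟨c, hc, hvc⟩ := H.exists_pos_smul_of_isOuterNormal h2
  change ‖outerUnitNormal L p‖ = 1 at h1
  change outerUnitNormal L p = c • F p at hvc
  rw [hvc, norm_smul, Real.norm_of_nonneg hc.le] at h1
  rw [hvc, eq_inv_of_mul_eq_one_left h1]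

theorem outerUnitNormal_eventuallyEq (H : IsNormalChart L h F p) (hL : Convex ℝ L) :
    outerUnitNormal L =ᶠ[𝓝[frontier L] p] fun y => ‖F y‖⁻¹ • F y := by
  have h1 := H.eventually.filter_mono (nhdsWithin_le_nhds (s := frontier L))
  have h2 := H.eventually_value_of_mem_frontier.filter_mono
    (nhdsWithin_le_nhds (s := frontier L))
  filter_upwards [h1, h2, self_mem_nhdsWithin] with y h1 h2 h3
  exact (h1 (h2 h3)).outerUnitNormal_eq hL

/-- Derivatives within the boundary agree on the tangent space. -/
theorem hasFDerivWithinAt_unique (H : IsNormalChart L h F p) (hF : ContinuousAt F p)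
    {f : E n → E n} {D D' : E n →L[ℝ] E n} (hD : HasFDerivWithinAt f D (frontier L) p)
    (hD' : HasFDerivWithinAt f D' (frontier L) p) {v : E n} (hv : inner ℝ (F p) v = 0) :
    D v = D' v := by
  set ℓ : E n →L[ℝ] ℝ := innerSL ℝ ((-2 : ℝ) • F p) with hℓ
  have hstrict : HasStrictFDerivAt h ℓ p :=
    hasStrictFDerivAt_of_hasFDerivAt_of_continuousAt
      (f' := fun y => innerSL ℝ ((-2 : ℝ) • F y)) H.hasFDerivAt (by fun_prop)
  have hsurj : ℓ.range = ⊤ := by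
    rw [LinearMap.range_eq_top]
    refine LinearMap.surjective fun h0 => ?_
    have h1 := congrArg (fun f : E n →ₗ[ℝ] ℝ => f p) h0
    simp [hℓ, H.inner_eq] at h1
  -- The implicit function parametrizes a piece of the boundary over the tangent space, with
  -- derivative the inclusion at 0. Composing with it turns derivatives within the boundary into
  -- ordinary, hence unique, ones.
  have hφ := hstrict.to_implicitFunction hsurj
  set φ := hstrict.implicitFunction h ℓ hsurj (h p) with hφdef
  have hφ0 : φ 0 = p := hstrict.implicitFunction_apply_image hsurj
  have hlevel : ∀ᶠ w in 𝓝 (0 : ℓ.ker), h (φ w) = h p := by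
    have := hstrict.map_implicitFunction_eq hsurj
    have ht : Tendsto (fun w : ℓ.ker => (h p, w)) (𝓝 0) (𝓝 (h p, 0)) :=
      (Continuous.prodMk_right (h p)).tendsto 0
    exact ht.eventually this
  have hfront : ∀ᶠ w in 𝓝 (0 : ℓ.ker), φ w ∈ frontier L := by
    have hev : ∀ᶠ y in 𝓝 (φ 0), h y = 1 → IsNormalChart L h F y := by
      rw [hφ0]; exact H.eventually
    filter_upwards [hlevel, hφ.hasFDerivAt.continuousAt.eventually hev] with w h1 h2
    exact (h2 (h1.trans H.value)).mem_frontier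
  have hcomp : ∀ {B : E n →L[ℝ] E n}, HasFDerivWithinAt f B (frontier L) p →
      HasFDerivAt (f ∘ φ) (B ∘L ℓ.ker.subtypeL) 0 := fun {B} hB => by
    have hB' : HasFDerivWithinAt f B (frontier L) (φ 0) := by rwa [hφ0]
    exact (hB'.comp (0 : ℓ.ker) (hφ.hasFDerivAt.hasFDerivWithinAt (s := φ ⁻¹' frontier L))
      (Set.mapsTo_preimage _ _)).hasFDerivAt hfront
  have huniq := (hcomp hD).unique (hcomp hD')
  have hvk : v ∈ ℓ.ker := by
    simp [hℓ, LinearMap.mem_ker, hv]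
  exact congrArg (fun B : ℓ.ker →L[ℝ] E n => B ⟨v, hvk⟩) huniq

theorem gaussCurvature_eq (H : IsNormalChart L h F p) (hL : Convex ℝ L)
    {A : E n →L[ℝ] E n} (hA : HasFDerivAt F A p) :
    gaussCurvature L p =
      (‖F p‖⁻¹) ^ (n - 1) * (compression (Submodule.span ℝ {F p})ᗮ A).det := by
  have hFp : ‖F p‖ ≠ 0 := norm_ne_zero_iff.2 H.normal_ne_zero
  have hinv : DifferentiableAt ℝ (fun y => ‖F y‖⁻¹) p :=
    (hA.differentiableAt.norm ℝ H.normal_ne_zero).inv hFp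
  have hN := hinv.hasFDerivAt.smul hA
  have hN' := (hN.hasFDerivWithinAt (s := frontier L)).congr_of_eventuallyEq
    (H.outerUnitNormal_eventuallyEq hL) (H.outerUnitNormal_eq hL)
  have hspan : tangentSpace L p = (Submodule.span ℝ {F p})ᗮ := by
    rw [tangentSpace, H.outerUnitNormal_eq hL,
      Submodule.span_singleton_smul_eq (IsUnit.mk0 _ (inv_ne_zero hFp))]
  have hW : gaussCurvature L p = (compression (Submodule.span ℝ {F p})ᗮ
      (fderivWithin ℝ (outerUnitNormal L) (frontier L) p)).det := by
    rw [← hspan]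
    rfl
  set S := (Submodule.span ℝ {F p})ᗮ with hS
  have hcompr : compression S (fderivWithin ℝ (outerUnitNormal L) (frontier L) p) =
      ‖F p‖⁻¹ • compression S A := by
    ext1 v
    have hv : inner ℝ (F p) (v : E n) = 0 := mem_orthogonal_span_singleton.1 v.2
    -- The derivative of the factor ‖F‖⁻¹ contributes only a multiple of F p, which the projection
    -- kills.
    have hproj : S.orthogonalProjectionOnto (F p) = 0 :=
      Submodule.orthogonalProjectionOnto_orthogonalComplement_singleton_eq_zero (F p)
    have hD := H.hasFDerivWithinAt_unique hA.continuousAt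
      hN'.differentiableWithinAt.hasFDerivWithinAt hN' hv
    simp [compression, hD, hproj]
  have hrank : finrank ℝ S = n - 1 := by
    have h1 := Submodule.finrank_add_finrank_orthogonal (Submodule.span ℝ {F p})
    rw [finrank_span_singleton H.normal_ne_zero, finrank_euclideanSpace_fin] at h1
    exact Nat.eq_sub_of_add_eq' h1
  rw [hW, hcompr, ContinuousLinearMap.det, ContinuousLinearMap.det,
    ContinuousLinearMap.toLinearMap_smul, LinearMap.det_smul, hrank]

end IsNormalChart

/-! ### Passage to the copolar set. -/

theorem convex_copolar {n : ℕ} (K : Set (E n)) : Convex ℝ (copolar K) := by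
  intro u hu w hw a b ha hb hab z hz
  rw [inner_add_left, real_inner_smul_left, real_inner_smul_left]
  nlinarith [hu z hz, hw z hz]

/-- A local inverse of the normal map of a chart is the normal map of a chart of the copolar
set. -/
theorem IsNormalChart.copolar {n : ℕ} {K : Set (E n)} {h : E n → ℝ} {F G : E n → E n} {x : E n}
    (H : IsNormalChart K h F x) (hmem : ∀ᶠ y in 𝓝 x, (F y ∈ copolar K ↔ 1 ≤ h y))
    (hG : ContDiffAt ℝ 1 G (F x)) (hGx : G (F x) = x) (hFG : ∀ᶠ u in 𝓝 (F x), F (G u) = u) :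
    IsNormalChart (PseudoCone.copolar K) (h ∘ G) G (F x) := by
  have hGlim : Tendsto G (𝓝 (F x)) (𝓝 x) := by
    simpa only [hGx] using hG.continuousAt.tendsto
  have hinner : ∀ᶠ u in 𝓝 (F x), inner ℝ (G u) u = -(h ∘ G) u := by
    filter_upwards [hGlim.eventually H.inner_self, hFG] with u h1 h2
    rw [h2, real_inner_comm] at h1
    exact h1
  refine ⟨?_, ?_, hinner, by simp [hGx, H.value]⟩
  · filter_upwards [hGlim.eventually hmem, hFG] with u h1 h2
    rwa [h2] at h1
  · filter_upwards [hGlim.eventually H.hasFDerivAt, hFG, hG.eventually (by simp),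
      hinner.eventually_nhds] with u h1 h2 h3 h4
    have hGd := (h3.differentiableAt one_ne_zero).hasFDerivAt
    have hd := h1.comp u hGd
    have hd' := ((hGd.inner ℝ (hasFDerivAt_id u)).neg).congr_of_eventuallyEq
      (f₁ := h ∘ G) (h4.mono fun w hw => by simp [hw])
    -- Two formulas for the derivative of h ∘ G in direction v, -2⟨u, DG v⟩ and -⟨DG v, u⟩ - ⟨G u,
    -- v⟩, give ⟨u, DG v⟩ = ⟨G u, v⟩, so the gradient is -2 G u.
    have heq := hd.unique hd'
    have hB : innerSL ℝ ((-2 : ℝ) • G u) =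
        innerSL ℝ ((-2 : ℝ) • F (G u)) ∘L fderiv ℝ G u := by
      ext1 v
      have hv := congrArg (fun B : E n →L[ℝ] ℝ => B v) heq
      simp [h2] at hv ⊢
      linarith [real_inner_comm u (fderiv ℝ G u v)]
    rw [hB]
    exact hd

/-! ### The radial function and the squared gauge of a pseudo-cone. -/

section Radial

variable {n : ℕ} {C : ProperCone ℝ (E n)} {K : Set (E n)}

theorem IsCPseudoCone.exists_smul_mem (hK : IsCPseudoCone C K) {y : E n}
    (hy : y ∈ interior (C : Set (E n))) : ∃ c : ℝ, 0 < c ∧ c • y ∈ K := by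
  obtain ⟨z, hz⟩ := hK.isPseudoCone.nonempty
  have hlim : Tendsto (fun t : ℝ => y - t • z) (𝓝[>] 0) (𝓝 y) := by
    have hc : Continuous fun t : ℝ => y - t • z := by fun_prop
    have := hc.tendsto 0
    simp only [zero_smul, sub_zero] at this
    exact this.mono_left nhdsWithin_le_nhds
  obtain ⟨t, ht, ht0 : 0 < t⟩ :=
    ((hlim.eventually (mem_interior_iff_mem_nhds.1 hy)).and self_mem_nhdsWithin).exists
  -- For small t, y - t z still lies in C, and t⁻¹ y = z + t⁻¹ (y - t z).
  refine ⟨t⁻¹, inv_pos.2 ht0, ?_⟩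
  have hrec : y - t • z ∈ recessionCone K := by
    rw [hK.recessionCone_eq]; exact ht
  have := hrec z hz t⁻¹ (inv_pos.2 ht0).le
  rwa [smul_sub, smul_smul, inv_mul_cancel₀ ht0.ne', one_smul, add_sub_cancel] at this

theorem radialFunction_smul_mem (hK : IsCPseudoCone C K) {y : E n}
    (hy : y ∈ interior (C : Set (E n))) : radialFunction K y • y ∈ K := by
  obtain ⟨c₀, hc₀⟩ := hK.exists_smul_mem hy
  have hclosed : IsClosed {t : ℝ | t • y ∈ K} :=
    hK.isPseudoCone.isClosed.preimage (by fun_prop : Continuous fun t : ℝ => t • y)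
  have hinf := csInf_mem_closure (s := {c : ℝ | 0 < c ∧ c • y ∈ K}) ⟨c₀, hc₀⟩
    ⟨0, fun c hc => hc.1.le⟩
  exact closure_minimal (fun c hc => hc.2) hclosed hinf

theorem radialFunction_pos (hK : IsCPseudoCone C K) {y : E n}
    (hy : y ∈ interior (C : Set (E n))) : 0 < radialFunction K y := by
  refine lt_of_le_of_ne (Real.sInf_nonneg fun c hc => hc.1.le) fun h0 => ?_
  have := radialFunction_smul_mem hK hy
  rw [← h0, zero_smul] at this
  exact hK.isPseudoCone.zero_notMem this

theorem smul_mem_iff_radialFunction_le (hK : IsCPseudoCone C K) {y : E n}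
    (hy : y ∈ interior (C : Set (E n))) {c : ℝ} (hc : 0 < c) :
    c • y ∈ K ↔ radialFunction K y ≤ c := by
  refine ⟨fun h => csInf_le ⟨0, fun c hc => hc.1.le⟩ ⟨hc, h⟩, fun h => ?_⟩
  have hpos := radialFunction_pos hK hy
  have := hK.isPseudoCone.smul_mem (c / radialFunction K y) ((one_le_div hpos).2 h) _
    (radialFunction_smul_mem hK hy)
  rwa [smul_smul, div_mul_cancel₀ _ hpos.ne'] at this

theorem radialFunction_smul (hK : IsCPseudoCone C K) {y : E n}
    (hy : y ∈ interior (C : Set (E n))) {t : ℝ} (ht : 0 < t)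
    (hty : t • y ∈ interior (C : Set (E n))) :
    radialFunction K (t • y) = radialFunction K y / t := by
  have hiff : ∀ c : ℝ, 0 < c → (radialFunction K (t • y) ≤ c ↔ radialFunction K y / t ≤ c) :=
    fun c hc => by
      rw [← smul_mem_iff_radialFunction_le hK hty hc, smul_smul,
        smul_mem_iff_radialFunction_le hK hy (mul_pos hc ht), div_le_iff₀ ht]
  exact le_antisymm ((hiff _ (div_pos (radialFunction_pos hK hy) ht)).2 le_rfl)
    ((hiff _ (radialFunction_pos hK hty)).1 le_rfl)

/-- The squared gauge function `1 / ρ_K²`. -/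
def gaugeSq {n : ℕ} (K : Set (E n)) (y : E n) : ℝ :=
  (radialFunction K y ^ 2)⁻¹

/-- The negative gradient of half the squared gauge function. -/
def gaugeNormal {n : ℕ} (K : Set (E n)) (y : E n) : E n :=
  (-(1 / 2) : ℝ) • (InnerProductSpace.toDual ℝ (E n)).symm (fderiv ℝ (gaugeSq K) y)

theorem contDiffOn_gaugeSq (hK : IsCPseudoCone C K)
    (hradial : ContDiffOn ℝ 2 (radialFunction K) (interior (C : Set (E n)))) :
    ContDiffOn ℝ 2 (gaugeSq K) (interior (C : Set (E n))) :=
  (hradial.pow 2).inv fun _ hy => pow_ne_zero 2 (radialFunction_pos hK hy).ne'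

theorem contDiffAt_gaugeNormal (hK : IsCPseudoCone C K)
    (hradial : ContDiffOn ℝ 2 (radialFunction K) (interior (C : Set (E n)))) {y : E n}
    (hy : y ∈ interior (C : Set (E n))) : ContDiffAt ℝ 1 (gaugeNormal K) y := by
  have h2 := (contDiffOn_gaugeSq hK hradial).contDiffAt (isOpen_interior.mem_nhds hy)
  have h1 : ContDiffAt ℝ 1 (fderiv ℝ (gaugeSq K)) y := h2.fderiv_right (by norm_num)
  exact ((InnerProductSpace.toDual ℝ (E n)).symm.contDiff.contDiffAt.comp y h1).const_smul _

theorem hasFDerivAt_gaugeSq (hK : IsCPseudoCone C K)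
    (hradial : ContDiffOn ℝ 2 (radialFunction K) (interior (C : Set (E n)))) {y : E n}
    (hy : y ∈ interior (C : Set (E n))) :
    HasFDerivAt (gaugeSq K) (innerSL ℝ ((-2 : ℝ) • gaugeNormal K y)) y := by
  have h2 := (contDiffOn_gaugeSq hK hradial).contDiffAt (isOpen_interior.mem_nhds hy)
  have hB : innerSL ℝ ((-2 : ℝ) • gaugeNormal K y) = fderiv ℝ (gaugeSq K) y := by
    ext1 v
    simp [gaugeNormal]
  rw [hB]
  exact (h2.differentiableAt two_ne_zero).hasFDerivAt

/-- Euler's identity for degree 2: differentiate h(t y) = t² h(y) at t = 1. -/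
theorem inner_gaugeNormal_self (hK : IsCPseudoCone C K)
    (hradial : ContDiffOn ℝ 2 (radialFunction K) (interior (C : Set (E n)))) {y : E n}
    (hy : y ∈ interior (C : Set (E n))) : inner ℝ (gaugeNormal K y) y = -gaugeSq K y := by
  have hline : HasDerivAt (fun t : ℝ => t • y) y 1 := by
    simpa using (hasDerivAt_id (1 : ℝ)).smul_const y
  have h1 : HasFDerivAt (gaugeSq K) (innerSL ℝ ((-2 : ℝ) • gaugeNormal K y)) ((1 : ℝ) • y) := by
    rw [one_smul]; exact hasFDerivAt_gaugeSq hK hradial hy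
  have hder := h1.comp_hasDerivAt (1 : ℝ) hline
  have hev : ∀ᶠ t : ℝ in 𝓝 1, (gaugeSq K ∘ fun t : ℝ => t • y) t = t ^ 2 * gaugeSq K y := by
    have hlim : Tendsto (fun t : ℝ => t • y) (𝓝 1) (𝓝 y) := by
      simpa using hline.continuousAt.tendsto
    filter_upwards [hlim.eventually (isOpen_interior.mem_nhds hy), lt_mem_nhds one_pos]
      with t ht ht0
    simp only [Function.comp_apply, gaugeSq, radialFunction_smul hK hy ht0 ht, div_pow, inv_div]
    rw [div_eq_mul_inv]
  have hder' : HasDerivAt (gaugeSq K ∘ fun t : ℝ => t • y) (2 * gaugeSq K y) 1 := by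
    have := ((hasDerivAt_pow 2 (1 : ℝ)).mul_const (gaugeSq K y)).congr_of_eventuallyEq hev
    simpa using this
  have := hder.unique hder'
  rw [innerSL_apply_apply, real_inner_smul_left] at this
  linarith

theorem mem_iff_one_le_gaugeSq (hK : IsCPseudoCone C K) {y : E n}
    (hy : y ∈ interior (C : Set (E n))) : y ∈ K ↔ 1 ≤ gaugeSq K y := by
  have hpos := radialFunction_pos hK hy
  have h1 := smul_mem_iff_radialFunction_le hK hy one_pos
  rw [one_smul] at h1
  rw [h1, gaugeSq, one_le_inv₀ (by positivity), sq_le_one_iff₀ hpos.le]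

/-- With r = ρ_K(y), the point y lies on the boundary of the convex set r⁻¹ K and minimizes the
squared gauge locally there, so the gradient is nonnegative towards r⁻¹ z. -/
theorem inner_gaugeNormal_le (hK : IsCPseudoCone C K)
    (hradial : ContDiffOn ℝ 2 (radialFunction K) (interior (C : Set (E n)))) {y z : E n}
    (hy : y ∈ interior (C : Set (E n))) (hz : z ∈ K) :
    inner ℝ (gaugeNormal K y) z ≤ -(radialFunction K y)⁻¹ := by
  set r := radialFunction K y with hr
  have hpos : 0 < r := radialFunction_pos hK hy
  set M : Set (E n) := (fun w => r • w) ⁻¹' K with hM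
  have hMconv : Convex ℝ M := hK.isPseudoCone.convex.smul_preimage r
  have hyM : y ∈ M := radialFunction_smul_mem hK hy
  have hzM : r⁻¹ • z ∈ M := by
    simp only [hM, Set.mem_preimage, smul_smul, mul_inv_cancel₀ hpos.ne', one_smul, hz]
  have hmin : IsLocalMinOn (gaugeSq K) M y := by
    filter_upwards [self_mem_nhdsWithin, nhdsWithin_le_nhds (isOpen_interior.mem_nhds hy)]
      with w hw hwC
    have h1 := (smul_mem_iff_radialFunction_le hK hwC hpos).1 hw
    have h2 := radialFunction_pos hK hwC
    exact inv_anti₀ (by positivity) (pow_le_pow_left₀ h2.le h1 2)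
  have hnonneg := hmin.hasFDerivWithinAt_nonneg
    (hasFDerivAt_gaugeSq hK hradial hy).hasFDerivWithinAt
    (sub_mem_posTangentConeAt_of_segment_subset (hMconv.segment_subset hyM hzM))
  rw [innerSL_apply_apply, real_inner_smul_left, inner_sub_right, real_inner_smul_right,
    inner_gaugeNormal_self hK hradial hy] at hnonneg
  have h3 : r⁻¹ * inner ℝ (gaugeNormal K y) z ≤ -gaugeSq K y := by linarith
  have h4 : inner ℝ (gaugeNormal K y) z = r * (r⁻¹ * inner ℝ (gaugeNormal K y) z) := by
    field_simp
  have h5 : -r⁻¹ = r * -gaugeSq K y := by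
    rw [gaugeSq, ← hr]
    field_simp
  rw [h4, h5]
  exact mul_le_mul_of_nonneg_left h3 hpos.le

theorem gaugeNormal_mem_copolar_iff (hK : IsCPseudoCone C K)
    (hradial : ContDiffOn ℝ 2 (radialFunction K) (interior (C : Set (E n)))) {y : E n}
    (hy : y ∈ interior (C : Set (E n))) :
    gaugeNormal K y ∈ copolar K ↔ 1 ≤ gaugeSq K y := by
  have hpos := radialFunction_pos hK hy
  rw [gaugeSq, one_le_inv₀ (by positivity), sq_le_one_iff₀ hpos.le]
  constructor
  · intro h
    -- Testing at the boundary point ρ_K(y) y gives -1/ρ_K(y) ≤ -1.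
    have h1 := h _ (radialFunction_smul_mem hK hy)
    rw [real_inner_smul_right, inner_gaugeNormal_self hK hradial hy, gaugeSq] at h1
    have h2 : radialFunction K y * -(radialFunction K y ^ 2)⁻¹ = -(radialFunction K y)⁻¹ := by
      field_simp
    rw [h2] at h1
    exact (one_le_inv₀ hpos).1 (by linarith)
  · intro h z hz
    have := (one_le_inv₀ hpos).2 h
    linarith [inner_gaugeNormal_le hK hradial hy hz]

theorem gaugeSq_eq_one_of_mem_frontier (hK : IsCPseudoCone C K)
    (hradial : ContDiffOn ℝ 2 (radialFunction K) (interior (C : Set (E n)))) {x : E n}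
    (hx : x ∈ interior (C : Set (E n))) (hfr : x ∈ frontier K) : gaugeSq K x = 1 := by
  have hxK : x ∈ K := hK.isPseudoCone.isClosed.frontier_subset hfr
  refine le_antisymm (not_lt.1 fun hlt => hfr.2 ?_) ((mem_iff_one_le_gaugeSq hK hx).1 hxK)
  have hc := (hasFDerivAt_gaugeSq hK hradial hx).continuousAt
  rw [mem_interior_iff_mem_nhds]
  filter_upwards [continuousAt_const.eventually_lt hc hlt, isOpen_interior.mem_nhds hx]
    with y hy hyC
  exact (mem_iff_one_le_gaugeSq hK hyC).2 hy.le

theorem isNormalChart_gaugeNormal (hK : IsCPseudoCone C K)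
    (hradial : ContDiffOn ℝ 2 (radialFunction K) (interior (C : Set (E n)))) {x : E n}
    (hx : x ∈ interior (C : Set (E n))) (hfr : x ∈ frontier K) :
    IsNormalChart K (gaugeSq K) (gaugeNormal K) x := by
  have hC := isOpen_interior.mem_nhds hx
  exact ⟨mem_of_superset hC fun y hy => mem_iff_one_le_gaugeSq hK hy,
    mem_of_superset hC fun y hy => hasFDerivAt_gaugeSq hK hradial hy,
    mem_of_superset hC fun y hy => inner_gaugeNormal_self hK hradial hy,
    gaugeSq_eq_one_of_mem_frontier hK hradial hx hfr⟩

end Radial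

/-! ### The derivative of the normal map. -/

/-- The normal map of a chart satisfies `⟨x, DF(x) v⟩ = ⟨F x, v⟩`. -/
theorem IsNormalChart.inner_fderiv {n : ℕ} {L : Set (E n)} {h : E n → ℝ} {F : E n → E n}
    {x : E n} (H : IsNormalChart L h F x) {A : E n →L[ℝ] E n} (hA : HasFDerivAt F A x)
    (v : E n) : inner ℝ x (A v) = inner ℝ (F x) v := by
  have h1 := (hA.inner ℝ (hasFDerivAt_id x)).congr_of_eventuallyEq
    (f₁ := fun y => -h y) (H.inner_self.mono fun y hy => by simp [hy])
  have heq := congrArg (fun B : E n →L[ℝ] ℝ => B v) (h1.unique H.hasFDerivAt.self_of_nhds.neg)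
  simp at heq
  linarith [real_inner_comm x (A v)]

/-- Where the Gauss curvature does not vanish, the normal map of a chart has an invertible
derivative. -/
theorem IsNormalChart.injective_fderiv {n : ℕ} {L : Set (E n)} {h : E n → ℝ} {F : E n → E n}
    {x : E n} (H : IsNormalChart L h F x) (hL : Convex ℝ L) {A : E n →L[ℝ] E n}
    (hA : HasFDerivAt F A x) (hcurv : gaussCurvature L x ≠ 0) : Function.Injective A := by
  rw [H.gaussCurvature_eq hL hA] at hcurv
  have hdet := right_ne_zero_of_mul hcurv
  have hker := LinearMap.ker_eq_bot'.1
    ((LinearMap.isUnit_iff_ker_eq_bot _).1 ((LinearMap.isUnit_iff_isUnit_det _).2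
      (isUnit_iff_ne_zero.2 hdet)))
  -- A kernel vector v satisfies ⟨F x, v⟩ = ⟨x, A v⟩ = 0, so it is tangent, where the compression is
  -- nonsingular.
  refine (injective_iff_map_eq_zero A).2 fun v hv => ?_
  have hvS : v ∈ (Submodule.span ℝ {F x})ᗮ := by
    rw [mem_orthogonal_span_singleton, ← H.inner_fderiv hA, hv, inner_zero_right]
  have := hker ⟨v, hvS⟩ (by simp [compression, hv])
  exact congrArg Subtype.val this

end PseudoCone

/-! ### The reciprocity theorem. -/

open PseudoCone

theorem mainTheorem3 (n : ℕ) (C : ProperCone ℝ (PseudoCone.E n)) (K : Set (PseudoCone.E n))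
    (hK : PseudoCone.IsCPseudoCone C K)
    (hradial : ContDiffOn ℝ 2 (PseudoCone.radialFunction K)
      (interior (C : Set (PseudoCone.E n))))
    (x x' : PseudoCone.E n) (hpair : PseudoCone.IsCrucialPair K x x')
    (hx : x ∈ interior (C : Set (PseudoCone.E n)))
    (hcurv : 0 < PseudoCone.gaussCurvature K x)
    (hcurv' : 0 < PseudoCone.gaussCurvature (PseudoCone.copolar K) x') :
    PseudoCone.equiaffineSupport K x *
      PseudoCone.equiaffineSupport (PseudoCone.copolar K) x' = 1 := by
  obtain ⟨hfr, hnormal, hinner⟩ := hpair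
  have H := isNormalChart_gaugeNormal hK hradial hx hfr
  have hconv := hK.isPseudoCone.convex
  -- The normal cone at x is a ray, and the pairing -1 fixes the scale.
  obtain rfl : gaugeNormal K x = x' := by
    obtain ⟨c, -, rfl⟩ := H.exists_pos_smul_of_isOuterNormal hnormal
    rw [real_inner_smul_right, real_inner_comm, H.inner_eq] at hinner
    rw [show c = 1 by linarith, one_smul]
  set F := gaugeNormal K with hF
  have hF1 : ContDiffAt ℝ 1 F x := contDiffAt_gaugeNormal hK hradial hx
  have hA := (hF1.differentiableAt one_ne_zero).hasFDerivAt
  let A : E n ≃L[ℝ] E n := (LinearEquiv.ofInjectiveEndo (fderiv ℝ F x : E n →ₗ[ℝ] E n)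
    (H.injective_fderiv hconv hA hcurv.ne')).toContinuousLinearEquiv
  have hA : HasFDerivAt F (A : E n →L[ℝ] E n) x := hA
  have hstrict := hF1.hasStrictFDerivAt' hA one_ne_zero
  set G := hF1.localInverse hA one_ne_zero with hG
  have hGx : G (F x) = x := hF1.localInverse_apply_image hA one_ne_zero
  have H' : IsNormalChart (copolar K) (gaugeSq K ∘ G) G (F x) :=
    H.copolar (mem_of_superset (isOpen_interior.mem_nhds hx) fun y hy =>
      gaugeNormal_mem_copolar_iff hK hradial hy)
      (hF1.to_localInverse hA one_ne_zero) hGx hstrict.eventually_right_inverse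
  have hGA : HasFDerivAt G (A.symm : E n →L[ℝ] E n) (F x) := hstrict.to_localInverse.hasFDerivAt
  have hx0 : x ≠ 0 := hGx ▸ H'.normal_ne_zero
  have hdet := det_compression_mul_det_compression_symm hx0 H.normal_ne_zero A
    (H.inner_fderiv hA)
  -- Needed for the truncated n - 1 to satisfy (n - 1) + 2 = n + 1 below.
  have hn : 1 ≤ n := by
    rcases n with _ | n
    · exact absurd (Subsingleton.elim x 0) hx0
    · omega
  have hκ := H.gaussCurvature_eq hconv hA
  have hκ' := H'.gaussCurvature_eq (convex_copolar K) hGA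
  have hν := H.outerUnitNormal_eq hconv
  have hν' := H'.outerUnitNormal_eq (convex_copolar K)
  rw [hGx] at hκ' hν'
  have hxF : inner ℝ x (F x) = -1 := hinner
  have hr : 0 < ‖x‖ * ‖F x‖ := mul_pos (norm_pos_iff.2 hx0) (norm_pos_iff.2 H.normal_ne_zero)
  have hprod : gaussCurvature K x * gaussCurvature (copolar K) (F x) =
      (‖x‖ * ‖F x‖) ^ (-((n : ℝ) + 1)) := by
    rw [hκ, hκ', mul_mul_mul_comm, hdet, hxF, Real.rpow_neg hr.le]
    have : ((n : ℝ) + 1) = ((n - 1 + 2 : ℕ) : ℝ) := by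
      push_cast [Nat.cast_sub hn]; ring
    rw [this, Real.rpow_natCast, pow_add, mul_pow, mul_pow]
    have h1 := norm_ne_zero_iff.2 hx0
    have h2 := norm_ne_zero_iff.2 H.normal_ne_zero
    rw [inv_pow, inv_pow]
    field_simp
  have hne : (n : ℝ) + 1 ≠ 0 := by positivity
  rw [equiaffineSupport, equiaffineSupport, mul_mul_mul_comm, ← Real.mul_rpow hcurv.le hcurv'.le,
    hprod, ← Real.rpow_mul hr.le, hν, hν', real_inner_smul_right, real_inner_smul_right,
    real_inner_comm, H.inner_eq,
    show -((n : ℝ) + 1) * -(1 / ((n : ℝ) + 1)) = 1 by field_simp, Real.rpow_one]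
  have h1 := norm_ne_zero_iff.2 hx0
  have h2 := norm_ne_zero_iff.2 H.normal_ne_zero
  field_simp

end
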